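/- **Setting.** Let $N\simeq\mathbb Z^n$ be a lattice, $M$ its dual, and $\Sigma$ a complete simplicial fan in $N_{\mathbb R}$, with (split) toric variety $X_\Sigma$. Let $\Sigma(k)$ be the set of its $k$-dimensional cones; for $\rho\in\Sigma(1)$ let $u_\rho$ be the minimal generator of $\rho$ and $D_\rho$ the corresponding toric divisor. Every divisor $D$ is linearly equivalent to a torus-invariant one $\sum_\rho a_\rho D_\rho$; put $P_D=\{m\in M_{\mathbb R}\mid \langle m,u_\rho\rangle\ge -a_\rho \ \forall\rho\in\Sigma(1)\}$. When $D$ is nef and Cartier, let $\Sigma_{[D]}$ be the (possibly degenerate) inner normal fan of $P_D$, which depends only on the class $[D]$, let $U_0$ be its minimal cone (a linear subspace), $N_0=U_0\cap N$, and let $\bar\Sigma_{[D]}=\{\sigma/U_0\mid\sigma\in\Sigma_{[D]}\}$ be the induced fan in $N_{\mathbb R}/U_0$. The projection $N\to N/N_0$ defines a toric morphism $\phi:X_\Sigma\to X_{\bar\Sigma_{[D]}}$. For a 1-cycle $C$ put $J_C=\{\rho\in\Sigma(1)\mid C\cdot D_\rho\neq0\}$ and $J_C^+=\{\rho\in\Sigma(1)\mid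 C\cdot D_\rho>0\}$. A nef Cartier divisor $D$ (or its class $[D]$) on $X_\Sigma$ has *global low toric degree* if there exist a 1-cycle $C$ on $X_\Sigma$ and a subset $I\subseteq J_C^+$ with at least two elements such that $$0<C\cdot D<\sum_{\rho\in I}C\cdot D_\rho\qquad\text{and}\qquad \forall \rho\in I,\ \exists\,\sigma\in\Sigma_{[D]}(n),\ J_C\setminus\{\rho\}\subset\sigma .$$ A *toric birational contraction* $\xi:X_\Sigma\dashrightarrow X_{\Sigma'}$ is a torus-equivariant birational map, given by an isomorphism of lattices $\bar\xi:N\to N'$, such that $\Sigma'(1)\subseteq\bar\xi(\Sigma(1))$; its pushforward $\xi_*$ on divisor classes sends $[D_\rho]$ to $[D'_{\bar\xi(\rho)}]$ if $\bar\xi(\rho)\in\Sigma'(1)$ and to $0$ otherwise. It is a map *over* $X_{\bar\Sigma_{[D]}}$ if there is a proper toric morphism $\phi':X_{\Sigma'}\to X_{\bar\Sigma_{[D]}}$ with $\phi'\circ\xi=\phi$. **Proposition 4.11.** Let $X_\Sigma$ be a complete simplicial toric variety and let $D$ be a nef Cartier divisor on $X_\Sigma$. Let $\xi:X_\Sigma\dashrightarrow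 X_{\Sigma'}$ be a toric birational contraction over $X_{\bar\Sigma_{[D]}}$ such that $X_{\Sigma'}$ is complete and simplicial. If $\xi_*[D]$ has global low toric degree, then so has $[D]$. -/

import Mathlib

open scoped TensorProduct

noncomputable section

namespace Toric

/-- The real vector space `N_ℝ = N ⊗ ℝ` spanned by a lattice `N`. -/
abbrev RealSpace (N : Type*) [AddCommGroup N] : Type _ := ℝ ⊗[ℤ] N

section Lattice

variable {N : Type*} [AddCommGroup N]

/-- The point `1 ⊗ u` of `N_ℝ` given by a lattice vector `u`. -/
def latticePt (u : N) : RealSpace N := (1 : ℝ) ⊗ₜ[ℤ] u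

/-- The cone `ℝ₊ u` spanned by a lattice vector. -/
def rayCone (u : N) : PointedCone ℝ (RealSpace N) := PointedCone.hull ℝ {latticePt u}

/-- The dimension of a cone is the dimension of its linear span. -/
def coneDim (σ : PointedCone ℝ (RealSpace N)) : ℕ :=
  Module.finrank ℝ (Submodule.span ℝ (σ : Set (RealSpace N)))

/-- A lattice vector is primitive if it is not a proper multiple of a lattice vector
(in particular it is nonzero). -/
def IsPrimitive (u : N) : Prop := ∀ (k : ℤ) (v : N), u = k • v → IsUnit k

end Lattice

/-- A fan in `N_ℝ`: a nonempty finite collection of strongly convex rational polyhedral cones, closed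
under taking faces, any two of which intersect along a common face. -/
structure Fan (N : Type*) [AddCommGroup N] where
  cones : Set (PointedCone ℝ (RealSpace N))
  nonempty : cones.Nonempty
  finite : cones.Finite
  rational : ∀ σ ∈ cones, ∃ S : Finset N, σ = PointedCone.hull ℝ (latticePt '' (S : Set N))
  salient : ∀ σ ∈ cones, (σ : ConvexCone ℝ (RealSpace N)).Salient
  face_mem : ∀ σ ∈ cones, ∀ τ : PointedCone ℝ (RealSpace N), τ.IsFaceOf σ → τ ∈ cones
  inf_isFaceOf : ∀ σ ∈ cones, ∀ τ ∈ cones, (σ ⊓ τ).IsFaceOf σ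

/-- A collection of cones `S` in `N_ℝ`, one `S'` in `N'_ℝ` and a lattice map `f : N → N'` are
compatible if the image of each cone of `S` is contained in a cone of `S'`; for fans this says
that `f` defines a toric morphism. -/
def IsCompatible {N N' : Type*} [AddCommGroup N] [AddCommGroup N'] (f : N →ₗ[ℤ] N')
    (S : Set (PointedCone ℝ (RealSpace N))) (S' : Set (PointedCone ℝ (RealSpace N'))) : Prop :=
  ∀ σ ∈ S, ∃ σ' ∈ S', σ.map (f.baseChange ℝ) ≤ σ'

namespace Fan

variable {N : Type*} [AddCommGroup N] (Δ : Fan N)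

/-- The fan covers `N_ℝ`. -/
def IsComplete : Prop := ∀ x : RealSpace N, ∃ σ ∈ Δ.cones, x ∈ σ

/-- Every cone is generated by linearly independent vectors. -/
def IsSimplicial : Prop := ∀ σ ∈ Δ.cones, PointedCone.IsSimplicial σ

/-- The set `Δ(1)` of one-dimensional cones; each such cone `ρ` is represented by its
minimal generator `u_ρ`, the primitive lattice vector spanning it. -/
def rays : Set N := {u | IsPrimitive u ∧ rayCone u ∈ Δ.cones}

/-- Torus-invariant Weil divisors `∑ a_ρ D_ρ`, given by their coefficients. -/
abbrev Div : Type _ := Δ.rays → ℤ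

/-- The divisor `∑ ⟨m, u_ρ⟩ D_ρ` of the character `m`. -/
def charDiv : Module.Dual ℤ N →ₗ[ℤ] Δ.Div where
  toFun m ρ := m ρ.1
  map_add' _ _ := rfl
  map_smul' _ _ := rfl

/-- The class group, i.e. the cokernel of `M → ℤ^{Δ(1)}`. -/
abbrev Cl : Type _ := Δ.Div ⧸ LinearMap.range Δ.charDiv

variable {Δ}

/-- The linear equivalence class `[D]`. -/
def divClass (D : Δ.Div) : Δ.Cl := Submodule.Quotient.mk D

open Classical in
/-- The toric prime divisor `D_ρ`. -/
def primeDiv (ρ : Δ.rays) : Δ.Div := Pi.single ρ 1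

variable (Δ)

/-- The space `N₁` of numerical classes of 1-cycles, the dual of `N¹ = Cl ⊗ ℝ`. The class of a
1-cycle `C` is the map `[D] ↦ C · D`. -/
abbrev N1 : Type _ := Δ.Cl →ₗ[ℤ] ℝ

variable {Δ}

/-- The intersection number `C · D`. -/
def inter (C : Δ.N1) (D : Δ.Div) : ℝ := C (divClass D)

/-- The class is rational, i.e. it is the class of a 1-cycle with rational coefficients;
equivalently, some positive integral multiple of it is the class of an integral 1-cycle. -/
def IsRational (C : Δ.N1) : Prop := ∀ D : Δ.Div, ∃ q : ℚ, inter C D = q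

/-- `J_C = {ρ | C · D_ρ ≠ 0}`. -/
def J (C : Δ.N1) : Set Δ.rays := {ρ | inter C (primeDiv ρ) ≠ 0}

/-- `J_C⁺ = {ρ | C · D_ρ > 0}`. -/
def Jpos (C : Δ.N1) : Set Δ.rays := {ρ | 0 < inter C (primeDiv ρ)}

/-- `C` is a positive multiple of the class of the toric curve `C_τ` of the wall `τ ∈ Δ(n-1)`.
For `ρ` not in `τ`, the number `C_τ · D_ρ` is `mult(τ) / mult(τ + ρ) > 0` if `τ + ρ` is a cone of the
fan and `0` otherwise. Conversely, on a complete simplicial fan this sign pattern determines a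
class up to a positive factor: there are exactly two `ρ` of the first kind, and
the relation `∑ (C · D_ρ) u_ρ = 0` fixes the ratio of the two numbers as well as
the numbers `C · D_ρ` for `ρ` in `τ`. -/
def IsToricCurveMultiple (τ : PointedCone ℝ (RealSpace N)) (C : Δ.N1) : Prop :=
  ∀ ρ : Δ.rays, latticePt ρ.1 ∉ τ →
    (τ ⊔ rayCone ρ.1 ∈ Δ.cones → 0 < inter C (primeDiv ρ)) ∧
    (τ ⊔ rayCone ρ.1 ∉ Δ.cones → inter C (primeDiv ρ) = 0)

variable (Δ)

/-- The Mori cone, generated by the classes of the toric curves `C_τ`, where `τ ∈ Δ(n-1)`. -/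
def moriCone : PointedCone ℝ Δ.N1 :=
  PointedCone.hull ℝ {C | ∃ τ ∈ Δ.cones, coneDim τ + 1 = Module.finrank ℤ N ∧
    IsToricCurveMultiple τ C}

variable {Δ}

/-- `D` is nef: it has nonnegative intersection with every effective class of curves. -/
def IsNef (D : Δ.Div) : Prop := ∀ C ∈ Δ.moriCone, 0 ≤ inter C D

/-- `D = ∑ a_ρ D_ρ` is Cartier: on each affine chart `U_σ` it is the divisor of a character. -/
def IsCartier (D : Δ.Div) : Prop :=
  ∀ σ ∈ Δ.cones, ∃ m : Module.Dual ℤ N, ∀ ρ : Δ.rays, latticePt ρ.1 ∈ σ → m ρ.1 = -D ρ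

/-- The polytope `P_D = {m ∈ M_ℝ | ⟨m, u_ρ⟩ ≥ -a_ρ for all ρ}`. -/
def polytope (D : Δ.Div) : Set (Module.Dual ℝ (RealSpace N)) :=
  {m | ∀ ρ : Δ.rays, -(D ρ : ℝ) ≤ m (latticePt ρ.1)}

end Fan

section NormalFan

variable {N : Type*} [AddCommGroup N]

/-- The inner normal cone of `P` at `v`. -/
def normalCone (P : Set (Module.Dual ℝ (RealSpace N))) (v : Module.Dual ℝ (RealSpace N)) :
    PointedCone ℝ (RealSpace N) where
  carrier := {x | ∀ m ∈ P, v x ≤ m x}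
  add_mem' := by
    intro x y hx hy m hm
    rw [map_add, map_add]
    exact add_le_add (hx m hm) (hy m hm)
  zero_mem' := by
    intro m _
    rw [map_zero, map_zero]
  smul_mem' := by
    intro c x hx m hm
    have h := mul_le_mul_of_nonneg_left (hx m hm) c.2
    change v ((c : ℝ) • x) ≤ m ((c : ℝ) • x)
    rw [map_smul, map_smul, smul_eq_mul, smul_eq_mul]
    exact h

/-- The (possibly degenerate) normal fan `Δ_P` of a polytope `P`: the cones dual to the faces of
`P`. The cone dual to a face is the normal cone of `P` at any relative interior point of it. -/
def normalFan (P : Set (Module.Dual ℝ (RealSpace N))) : Set (PointedCone ℝ (RealSpace N)) :=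
  normalCone P '' P

/-- The lattice `N₀ = U₀ ∩ N`, where `U₀`, the orthogonal of the span of the differences of points
of `P`, is the minimal cone of the normal fan. -/
def minimalLattice (P : Set (Module.Dual ℝ (RealSpace N))) : Submodule ℤ N where
  carrier := {u | ∀ m ∈ P, ∀ m' ∈ P, m (latticePt u) = m' (latticePt u)}
  add_mem' := by
    intro u v hu hv m hm m' hm'
    simp only [latticePt, TensorProduct.tmul_add, map_add]
    exact congrArg₂ (· + ·) (hu m hm m' hm') (hv m hm m' hm')
  zero_mem' := by
    intro m _ m' _
    simp [latticePt]
  smul_mem' := by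
    intro c u hu m hm m' hm'
    simp only [latticePt, TensorProduct.tmul_smul, map_zsmul]
    exact congrArg (c • ·) (hu m hm m' hm')

/-- The lattice `N̄ = N / N₀` of the nondegenerate normal fan. -/
abbrev QuotLattice (P : Set (Module.Dual ℝ (RealSpace N))) : Type _ := N ⧸ minimalLattice P

/-- The nondegenerate normal fan `Δ̄_P` in `N̄_ℝ`: the images of the cones of `Δ_P`. -/
def reducedNormalFan (P : Set (Module.Dual ℝ (RealSpace N))) :
    Set (PointedCone ℝ (RealSpace (QuotLattice P))) :=
  (fun σ => σ.map ((minimalLattice P).mkQ.baseChange ℝ)) '' normalFan P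

end NormalFan

namespace Fan

variable {N : Type*} [AddCommGroup N] {Δ : Fan N}

/-- Global low toric degree of a (nef Cartier) divisor `D` on a complete simplicial toric variety:
there are a 1-cycle `C` and a set `I ⊆ J_C⁺` with at least two elements such that
`0 < C · D < ∑_{ρ ∈ I} C · D_ρ` and, for each `ρ ∈ I`, the set `J_C \ {ρ}` is contained in
an `n`-dimensional cone of `Δ_{[D]}`. -/
def HasGlobalLowToricDegree (D : Δ.Div) : Prop :=
  ∃ (C : Δ.N1) (I : Finset Δ.rays), IsRational C ∧ (I : Set Δ.rays) ⊆ Jpos C ∧ 2 ≤ I.card ∧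
    (0 < inter C D ∧ inter C D < ∑ ρ ∈ I, inter C (primeDiv ρ)) ∧
    ∀ ρ ∈ I, ∃ σ ∈ normalFan (polytope D), coneDim σ = Module.finrank ℤ N ∧
      ∀ ρ' ∈ J C \ {ρ}, latticePt ρ'.1 ∈ σ

end Fan

/-- A toric birational contraction `X_Δ ⇢ X_Δ'`: an isomorphism of lattices (birationality) such
that each ray of `Δ'` is the image of a ray of `Δ` (surjectivity in codimension one). -/
structure BirationalContraction {N N' : Type*} [AddCommGroup N] [AddCommGroup N']
    (Δ : Fan N) (Δ' : Fan N') where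
  toEquiv : N ≃ₗ[ℤ] N'
  rays_subset : Δ'.rays ⊆ toEquiv '' Δ.rays

namespace BirationalContraction

variable {N N' : Type*} [AddCommGroup N] [AddCommGroup N'] {Δ : Fan N} {Δ' : Fan N'}
  (ξ : BirationalContraction Δ Δ')

theorem symm_mem_rays (ρ' : Δ'.rays) : ξ.toEquiv.symm ρ'.1 ∈ Δ.rays := by
  obtain ⟨u, hu, h⟩ := ξ.rays_subset ρ'.2
  rw [← h, LinearEquiv.symm_apply_apply]
  exact hu

/-- Strict transform of rays: `Δ'(1)` as a subset of `Δ(1)`. -/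
def rayPreimage (ρ' : Δ'.rays) : Δ.rays := ⟨ξ.toEquiv.symm ρ'.1, ξ.symm_mem_rays ρ'⟩

/-- The pushforward of divisors: `ξ_* D_ρ` is `D'_ρ` if `ρ` is a ray of `Δ'` and `0` otherwise. -/
def pushDiv : Δ.Div →ₗ[ℤ] Δ'.Div where
  toFun D ρ' := D (ξ.rayPreimage ρ')
  map_add' _ _ := rfl
  map_smul' _ _ := rfl

/-- The pushforward `ξ_*` of divisor classes. -/
def pushClass : Δ.Cl →ₗ[ℤ] Δ'.Cl :=
  Submodule.mapQ _ _ ξ.pushDiv (by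
    rintro _ ⟨m, rfl⟩
    exact ⟨m ∘ₗ ξ.toEquiv.symm.toLinearMap, rfl⟩)

/-- `ξ` is a map over `X_{Δ̄_[D]}`: there is a toric morphism `φ' : X_Δ' → X_{Δ̄_[D]}` with
`φ' ∘ ξ = φ`, where `φ` is given by the quotient map `N → N / N₀`. When `Δ'` is complete, such a
`φ'` is automatically proper. -/
def IsOver (D : Δ.Div) : Prop :=
  ∃ φ' : N' →ₗ[ℤ] QuotLattice (Fan.polytope D),
    IsCompatible φ' Δ'.cones (reducedNormalFan (Fan.polytope D)) ∧
    φ' ∘ₗ ξ.toEquiv.toLinearMap = (minimalLattice (Fan.polytope D)).mkQ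

end BirationalContraction

end Toric

end

noncomputable section

namespace Toric

/-! ### Lattice vectors, primitive vectors and real extensions -/

section Lattice

variable {N : Type*} [AddCommGroup N]

/-! Pull the curve class `C` on `X_Δ'` back to `C ∘ ξ_*` (`pullCurve`). It meets the strict
transform of each ray of `Δ'` as `C` meets that ray, and meets contracted rays in `0`. So `J_C`,
`J_C⁺` and the degrees carry over, and only the condition on `n`-dimensional cones remains: the
normal fans of `P_D` and `P_D'` must correspond under `ξ`.

A character relating `D'` to `ξ_* D` translates the polytope. Apart from that, `P_D'` only lacks the
inequalities of the contracted rays, and these are redundant (`IsOver.mem_polytope`). A contracted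
ray `ρ` lies in a cone `σ'` of `Δ'`, and since `ξ` is over `X_{Δ̄_[D]}`, `σ'` lies in the normal
cone of `P_D` at some `v`. At the generators of `σ'`, `v` attains the minimum over `P_D`, which
nefness identifies with the bound `-a`. A form `m` satisfying the remaining inequalities thus
dominates `v` on `σ'`, so `m(u_ρ) ≥ v(u_ρ) ≥ -a_ρ`.

The nefness input is that local equations of `D` lie in `P_D` (`IsNef.exists_local_equation`).
Testing against toric curves gives only convexity of the support function across one wall
(`IsNef.realDual_le_of_adjacent`). It is globalised along a segment from a generic point of a cone
to a ray generator. -/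

lemma latticePt_zsmul (k : ℤ) (u : N) : latticePt (k • u) = (k : ℝ) • latticePt u := by
  simp only [latticePt, TensorProduct.tmul_smul]
  exact (Int.cast_smul_eq_zsmul ℝ k _).symm

lemma latticePt_zero : latticePt (0 : N) = 0 := TensorProduct.tmul_zero _ _

lemma span_range_latticePt : Submodule.span ℝ (Set.range (latticePt : N → RealSpace N)) = ⊤ := by
  rw [eq_top_iff]
  rintro x -
  induction x using TensorProduct.induction_on with
  | zero => exact zero_mem _
  | add x y hx hy => exact add_mem hx hy
  | tmul a u =>
    have : a ⊗ₜ[ℤ] u = a • latticePt u := by simp [latticePt, TensorProduct.smul_tmul']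
    rw [this]
    exact Submodule.smul_mem _ _ (Submodule.subset_span ⟨u, rfl⟩)

lemma IsPrimitive.ne_zero {u : N} (hu : IsPrimitive u) : u ≠ 0 := by
  rintro rfl
  simpa using hu 0 0 (by simp)

/-- The real extension of an integral linear form. -/
def realDual (m : Module.Dual ℤ N) : Module.Dual ℝ (RealSpace N) :=
  LinearMap.liftBaseChange ℝ ((Int.castAddHom ℝ).toIntLinearMap ∘ₗ m)

@[simp] lemma realDual_latticePt (m : Module.Dual ℤ N) (u : N) :
    realDual m (latticePt u) = (m u : ℝ) := by
  simp [realDual, latticePt]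

@[simp] lemma baseChange_latticePt {N' : Type*} [AddCommGroup N'] (f : N →ₗ[ℤ] N') (u : N) :
    f.baseChange ℝ (latticePt u) = latticePt (f u) := by
  simp [latticePt]

variable [Module.Free ℤ N]

lemma latticePt_injective : Function.Injective (latticePt : N → RealSpace N) := by
  intro u v h
  let b := Module.Free.chooseBasis ℤ N
  refine b.repr.injective (Finsupp.ext fun i => ?_)
  have := congrArg (realDual (b.coord i)) h
  simpa using this

/-- Every nonzero lattice vector is a positive multiple of a primitive one. -/
lemma exists_isPrimitive_smul (s : N) (hs : s ≠ 0) :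
    ∃ (u : N) (k : ℤ), IsPrimitive u ∧ 0 < k ∧ s = k • u := by
  let b := Module.Free.chooseBasis ℤ N
  obtain ⟨i, hi⟩ : ∃ i, b.repr s i ≠ 0 := by
    by_contra! h
    exact hs (b.repr.injective (by ext i; simpa using h i))
  -- Dividing `s` by a nonunit strictly decreases the size of a fixed nonzero coordinate.
  induction hn : (b.repr s i).natAbs using Nat.strong_induction_on generalizing s with
  | _ n ih =>
    by_cases hp : IsPrimitive s
    · exact ⟨s, 1, hp, one_pos, (one_smul _ _).symm⟩
    · simp only [IsPrimitive, not_forall] at hp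
      obtain ⟨k, v, rfl, hk⟩ := hp
      wlog hk0 : 0 ≤ k generalizing k v
      · exact this (-k) (-v) (by simpa using hk) (by simpa using hs) (by simpa using hi)
          (by simpa using hn) (by lia) |>.imp fun u ⟨k, h1, h2, h3⟩ => ⟨k, h1, h2, by simpa using h3⟩
      have hk1 : k ≠ 0 := by rintro rfl; simp at hs
      have hk2 : k ≠ 1 := by rintro rfl; simp at hk
      have hv : v ≠ 0 := by rintro rfl; simp at hs
      have hvi : b.repr v i ≠ 0 := by intro h; simp [h] at hi
      have hlt : (b.repr v i).natAbs < n := by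
        rw [← hn]
        simp only [map_smul, Finsupp.smul_apply, smul_eq_mul, Int.natAbs_mul]
        have : 0 < (b.repr v i).natAbs := Int.natAbs_pos.2 hvi
        have : 2 ≤ k.natAbs := by lia
        nlinarith
      obtain ⟨u, l, hu, hl, h⟩ := ih _ hlt v hv hvi rfl
      exact ⟨u, k * l, hu, by positivity, by rw [h, mul_smul]⟩

/-- Two primitive vectors spanning the same ray are equal. -/
lemma IsPrimitive.eq_of_latticePt_eq_smul {u v : N} (hu : IsPrimitive u) (hv : IsPrimitive v)
    {s : ℝ} (hs : 0 ≤ s) (h : latticePt u = s • latticePt v) : u = v := by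
  let b := Module.Free.chooseBasis ℤ N
  obtain ⟨i, hi⟩ : ∃ i, b.repr v i ≠ 0 := by
    by_contra! h
    exact hv.ne_zero (b.repr.injective (by ext i; simpa using h i))
  have h1 : ((b.repr u i : ℤ) : ℝ) = s * (b.repr v i : ℤ) := by
    simpa using congrArg (realDual (b.coord i)) h
  have h2 : ((b.repr v i : ℤ) : ℝ) ≠ 0 := by exact_mod_cast hi
  obtain ⟨q, hq⟩ : ∃ q : ℚ, s = q :=
    ⟨(b.repr u i : ℤ) / (b.repr v i : ℤ), by push_cast; field_simp; linarith⟩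
  subst hq
  have hd : ((q.den : ℤ) : ℝ) * (q : ℝ) = (q.num : ℤ) := by
    exact_mod_cast Rat.den_mul_eq_num q
  have h3 : (q.den : ℤ) • u = q.num • v := by
    apply latticePt_injective
    rw [latticePt_zsmul, latticePt_zsmul, h, smul_smul, hd]
  -- By Bézout, `x • u + y • v` times the denominator is `v` and times the numerator is `u`.
  -- Primitivity makes both factors units.
  obtain ⟨x, y, hxy⟩ : IsCoprime q.num (q.den : ℤ) := Rat.isCoprime_num_den q
  have hvd : IsUnit (q.den : ℤ) := hv _ (x • u + y • v) (by
    calc v = (x * q.num + y * q.den) • v := by rw [hxy, one_smul]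
      _ = x • (q.num • v) + (q.den : ℤ) • y • v := by
        rw [add_smul, mul_smul, mul_comm y, mul_smul]
      _ = _ := by rw [← h3, smul_comm, smul_add])
  have hun : IsUnit q.num := hu _ (x • u + y • v) (by
    calc u = (x * q.num + y * q.den) • u := by rw [hxy, one_smul]
      _ = q.num • x • u + y • (q.den : ℤ) • u := by
        rw [add_smul, mul_comm x, mul_smul, mul_smul]
      _ = _ := by rw [h3, smul_comm y, smul_add])
  have hq0 : 0 ≤ q := by exact_mod_cast hs
  have h4 : q.num = 1 := by
    have := Rat.num_nonneg.2 hq0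
    rcases Int.isUnit_iff.1 hun with h | h <;> lia
  have h5 : (q.den : ℤ) = 1 := by
    rcases Int.isUnit_iff.1 hvd with h | h <;> lia
  simpa [h4, h5] using h3

end Lattice

/-! ### Simplicial cones and their rays -/

section Cone

variable {V : Type*} [AddCommGroup V] [Module ℝ V]

lemma mem_hull_range_iff {ι : Type*} [Fintype ι] (v : ι → V) (x : V) :
    x ∈ PointedCone.hull ℝ (Set.range v) ↔ ∃ c : ι → ℝ, (∀ i, 0 ≤ c i) ∧ x = ∑ i, c i • v i := by
  rw [PointedCone.hull, Submodule.mem_span_range_iff_exists_fun]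
  constructor
  · rintro ⟨c, rfl⟩
    exact ⟨fun i => c i, fun i => (c i).2, rfl⟩
  · rintro ⟨c, hc, rfl⟩
    exact ⟨fun i => ⟨c i, hc i⟩, rfl⟩

lemma mem_hull_singleton_iff {v x : V} :
    x ∈ PointedCone.hull ℝ {v} ↔ ∃ c : ℝ, 0 ≤ c ∧ x = c • v := by
  rw [PointedCone.hull, Submodule.mem_span_singleton]
  constructor
  · rintro ⟨c, rfl⟩
    exact ⟨c, c.2, rfl⟩
  · rintro ⟨c, hc, rfl⟩
    exact ⟨⟨c, hc⟩, rfl⟩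

lemma hull_singleton_smul {v : V} {c : ℝ} (hc : 0 < c) :
    PointedCone.hull ℝ {c • v} = PointedCone.hull ℝ {v} := by
  ext x
  rw [mem_hull_singleton_iff, mem_hull_singleton_iff]
  constructor
  · rintro ⟨d, hd, rfl⟩
    exact ⟨d * c, by positivity, by rw [mul_smul]⟩
  · rintro ⟨d, hd, rfl⟩
    exact ⟨d / c, by positivity, by rw [smul_smul, div_mul_cancel₀ _ hc.ne']⟩

lemma exists_fin_of_isSimplicial {σ : PointedCone ℝ V} (h : PointedCone.IsSimplicial σ) :
    ∃ (k : ℕ) (v : Fin k → V), LinearIndependent ℝ v ∧ σ = PointedCone.hull ℝ (Set.range v) := by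
  obtain ⟨s, hs, hli, rfl⟩ := h
  have : Fintype s := hs.fintype
  let e := Fintype.equivFin s
  refine ⟨_, fun i => (e.symm i : V), ?_, ?_⟩
  · exact LinearIndependent.comp hli e.symm e.symm.injective
  · congr 1
    ext x
    constructor
    · intro hx
      exact ⟨e ⟨x, hx⟩, by simp⟩
    · rintro ⟨i, rfl⟩
      exact (e.symm i).2

/-- The rays through the generators of a simplicial cone are faces. -/
lemma hull_singleton_isFaceOf {ι : Type*} [Fintype ι] {v : ι → V}
    (hv : LinearIndependent ℝ v) (i : ι) :
    (PointedCone.hull ℝ {v i}).IsFaceOf (PointedCone.hull ℝ (Set.range v)) where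
  le := Submodule.span_mono (by simp)
  mem_of_smul_add_mem := by
    classical
    intro x y a hx hy ha hxy
    rw [mem_hull_range_iff] at hx hy
    obtain ⟨c, hc, rfl⟩ := hx
    obtain ⟨d, hd, rfl⟩ := hy
    rw [mem_hull_singleton_iff] at hxy
    obtain ⟨e, he, h⟩ := hxy
    -- Linear independence allows comparing coefficients: for `j ≠ i` the nonnegative terms `a * c
    -- j` and `d j` sum to zero.
    have h' : ∑ j, (a * c j + d j - if j = i then e else 0) • v j = 0 := by
      simp only [sub_smul, add_smul, mul_smul, Finset.sum_sub_distrib, Finset.sum_add_distrib,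
        ← Finset.smul_sum, h, ite_smul, zero_smul, Finset.sum_ite_eq', Finset.mem_univ, if_true,
        sub_self]
    rw [Fintype.linearIndependent_iff] at hv
    have hz := hv _ h'
    rw [mem_hull_singleton_iff]
    refine ⟨c i, hc i, Finset.sum_eq_single i (fun j _ hj => ?_) (by simp)⟩
    have := hz j
    rw [if_neg hj] at this
    have h0 : c j = 0 := by
      have := hc j
      have := hd j
      have : 0 ≤ a * c j := by positivity
      have : a * c j = 0 := by linarith
      exact (mul_eq_zero.1 this).resolve_left ha.ne'
    rw [h0, zero_smul]

end Cone

/-! ### Primitive generators of the cones of a simplicial fan -/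

namespace Fan

variable {N : Type*} [AddCommGroup N] [Module.Free ℤ N] {Δ : Fan N}

/-- A cone of the fan spanned by one nonzero vector is spanned by the primitive generator of a
ray. -/
lemma exists_ray_of_hull_singleton_mem {v : RealSpace N} (hv : v ≠ 0)
    (h : PointedCone.hull ℝ {v} ∈ Δ.cones) :
    ∃ (r : Δ.rays) (c : ℝ), 0 < c ∧ latticePt r.1 = c • v := by
  obtain ⟨S, hS⟩ := Δ.rational _ h
  obtain ⟨s, hs, hs0⟩ : ∃ s ∈ S, latticePt s ≠ 0 := by
    by_contra! h0
    have : PointedCone.hull ℝ {v} ≤ ⊥ := by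
      rw [hS]
      refine Submodule.span_le.2 ?_
      rintro _ ⟨s, hs, rfl⟩
      exact h0 s hs
    exact hv (this (Submodule.subset_span rfl))
  have hsv : latticePt s ∈ PointedCone.hull ℝ {v} := by
    rw [hS]
    exact Submodule.subset_span ⟨s, hs, rfl⟩
  obtain ⟨c, hc, hcv⟩ := mem_hull_singleton_iff.1 hsv
  have hc0 : 0 < c := by
    refine lt_of_le_of_ne hc ?_
    rintro rfl
    exact hs0 (by rw [hcv, zero_smul])
  obtain ⟨u, k, hu, hk, rfl⟩ := exists_isPrimitive_smul s (by rintro rfl; exact hs0 latticePt_zero)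
  have hk' : (0 : ℝ) < k := by exact_mod_cast hk
  have huv : latticePt u = (c / k) • v := by
    rw [div_eq_inv_mul, mul_smul, ← hcv, latticePt_zsmul, inv_smul_smul₀ hk'.ne']
  refine ⟨⟨u, hu, ?_⟩, c / k, by positivity, huv⟩
  rw [rayCone, huv, hull_singleton_smul (by positivity)]
  exact h

/-- A cone of a simplicial fan is generated by linearly independent primitive ray generators. -/
lemma IsSimplicial.exists_rays (hs : Δ.IsSimplicial) {σ : PointedCone ℝ (RealSpace N)}
    (hσ : σ ∈ Δ.cones) :
    ∃ (k : ℕ) (r : Fin k → Δ.rays), LinearIndependent ℝ (fun i => latticePt (r i).1) ∧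
      σ = PointedCone.hull ℝ (Set.range fun i => latticePt (r i).1) := by
  obtain ⟨k, v, hv, rfl⟩ := exists_fin_of_isSimplicial (hs σ hσ)
  choose r c hc hr using fun i => exists_ray_of_hull_singleton_mem (hv.ne_zero i)
    (Δ.face_mem _ hσ _ (hull_singleton_isFaceOf hv i))
  refine ⟨k, r, ?_, ?_⟩
  · simp only [hr]
    exact hv.units_smul (fun i => Units.mk0 (c i) (hc i).ne')
  · ext x
    rw [mem_hull_range_iff, mem_hull_range_iff]
    constructor
    · rintro ⟨d, hd, rfl⟩
      refine ⟨fun i => d i / c i, fun i => div_nonneg (hd i) (hc i).le, ?_⟩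
      refine Finset.sum_congr rfl fun i _ => ?_
      rw [hr, smul_smul, div_mul_cancel₀ _ (hc i).ne']
    · rintro ⟨d, hd, rfl⟩
      refine ⟨fun i => d i * c i, fun i => mul_nonneg (hd i) (hc i).le, ?_⟩
      refine Finset.sum_congr rfl fun i _ => ?_
      rw [hr, smul_smul]

/-- A full-dimensional cone of a simplicial fan is the positive orthant of a basis of primitive
ray generators. -/
lemma IsSimplicial.exists_basis (hs : Δ.IsSimplicial) {σ : PointedCone ℝ (RealSpace N)}
    (hσ : σ ∈ Δ.cones) (htop : Submodule.span ℝ (σ : Set (RealSpace N)) = ⊤) :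
    ∃ (k : ℕ) (r : Fin k → Δ.rays) (b : Module.Basis (Fin k) ℝ (RealSpace N)),
      (∀ i, b i = latticePt (r i).1) ∧ ∀ x, x ∈ σ ↔ ∀ i, 0 ≤ b.repr x i := by
  obtain ⟨k, r, hli, rfl⟩ := hs.exists_rays hσ
  have hsp : ⊤ ≤ Submodule.span ℝ (Set.range fun i => latticePt (r i).1) := by
    rw [← htop]
    exact Submodule.span_le.2 (PointedCone.hull_le_span ℝ _)
  let b := Module.Basis.mk hli hsp
  have hb : ∀ i, b i = latticePt (r i).1 := fun i => Module.Basis.mk_apply hli hsp i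
  refine ⟨k, r, b, hb, fun x => ?_⟩
  rw [mem_hull_range_iff]
  simp only [← hb]
  constructor
  · rintro ⟨c, hc, rfl⟩ i
    rw [b.repr_sum_self]
    exact hc i
  · intro h
    exact ⟨fun i => b.repr x i, h, (b.sum_repr x).symm⟩

end Fan

/-! ### Faces and facets of a full-dimensional simplicial cone -/

section Orthant

variable {V : Type*} [AddCommGroup V] [Module ℝ V] {k : ℕ} {b : Module.Basis (Fin k) ℝ V}
  {τ F : PointedCone ℝ V}

lemma basis_mem_of_orthant (hb : ∀ x, x ∈ τ ↔ ∀ i, 0 ≤ b.repr x i) (i : Fin k) : b i ∈ τ := by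
  rw [hb]
  intro j
  rw [b.repr_self, Finsupp.single_apply]
  split_ifs <;> norm_num

/-- A face containing a positive combination of points of the cone contains each of them; faces are
thus determined by their generators. -/
lemma basis_mem_of_pos_repr (hb : ∀ x, x ∈ τ ↔ ∀ i, 0 ≤ b.repr x i) (hF : F.IsFaceOf τ) {x : V}
    (hx : x ∈ F) {i : Fin k} (hi : 0 < b.repr x i) : b i ∈ F :=
  hF.mem_of_sum_smul_mem (basis_mem_of_orthant hb) (fun j => (hb x).1 (hF.le hx) j)
    (by rwa [b.sum_repr]) i hi

lemma mem_of_basis_mem (hb : ∀ x, x ∈ τ ↔ ∀ i, 0 ≤ b.repr x i) {x : V} (hx : x ∈ τ)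
    (h : ∀ i, b.repr x i ≠ 0 → b i ∈ F) : x ∈ F := by
  rw [← b.sum_repr x]
  refine sum_mem fun i _ => ?_
  by_cases hi : b.repr x i = 0
  · rw [hi, zero_smul]
    exact zero_mem F
  · exact F.smul_mem ((hb x).1 hx i) (h i hi)

/-- A face of a simplicial cone that spans the whole space is the whole cone. -/
lemma eq_of_isFaceOf_of_span_eq_top (hb : ∀ x, x ∈ τ ↔ ∀ i, 0 ≤ b.repr x i) (hF : F.IsFaceOf τ)
    (h : Submodule.span ℝ (F : Set V) = ⊤) : F = τ := by
  refine le_antisymm hF.le fun x hx => mem_of_basis_mem hb hx fun i _ => ?_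
  by_contra hi
  have : Submodule.span ℝ (F : Set V) ≤ LinearMap.ker (b.coord i) := by
    refine Submodule.span_le.2 fun z hz => ?_
    have h0 := (hb z).1 (hF.le hz) i
    by_contra hne
    exact hi (basis_mem_of_pos_repr hb hF hz (lt_of_le_of_ne h0 (Ne.symm hne)))
  rw [h] at this
  simpa using this (Submodule.mem_top (x := b i))

/-- A proper face of a simplicial cone which, together with one more vector, spans the space,
is a facet. -/
lemma exists_facet_index (hb : ∀ x, x ∈ τ ↔ ∀ i, 0 ≤ b.repr x i) (hF : F.IsFaceOf τ)
    (hne : F ≠ τ) {x : V} (h : Submodule.span ℝ (F : Set V) ⊔ Submodule.span ℝ {x} = ⊤) :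
    ∃ j, b j ∉ F ∧ ∀ i, i ≠ j → b i ∈ F := by
  have key : ∀ i, b i ∉ F → ∀ z ∈ F, b.repr z i = 0 := by
    intro i hi z hz
    have h0 := (hb z).1 (hF.le hz) i
    by_contra hne
    exact hi (basis_mem_of_pos_repr hb hF hz (lt_of_le_of_ne h0 (Ne.symm hne)))
  obtain ⟨j, hj⟩ : ∃ j, b j ∉ F := by
    by_contra! hall
    exact hne (le_antisymm hF.le fun x hx => mem_of_basis_mem hb hx fun i _ => hall i)
  refine ⟨j, hj, fun i hij => ?_⟩
  by_contra hi
  have hker : ∀ φ : V →ₗ[ℝ] ℝ, (∀ z ∈ F, φ z = 0) → φ x = 0 → φ = 0 := by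
    intro φ h1 h2
    have : (⊤ : Submodule ℝ V) ≤ LinearMap.ker φ := by
      rw [← h]
      refine sup_le (Submodule.span_le.2 h1) (Submodule.span_le.2 ?_)
      rintro _ rfl
      exact h2
    ext v
    exact this (Submodule.mem_top (x := v))
  -- If two generators were missing, their coordinates would both vanish on `F`, and this
  -- combination of them also vanishes at `x`. It is therefore zero, which forces first `b.repr x i
  -- = 0` and then `b.coord i = 0`.
  have h1 := hker (b.repr x i • b.coord j - b.repr x j • b.coord i)
    (fun z hz => by simp [key i hi z hz, key j hj z hz]) (by simp [mul_comm])
  have h2 : b.repr x i = 0 := by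
    simpa [Finsupp.single_apply, hij, hij.symm] using LinearMap.congr_fun h1 (b j)
  have h3 := hker (b.coord i) (fun z hz => key i hi z hz) h2
  simpa using LinearMap.congr_fun h3 (b i)

lemma repr_eq_zero_of_mem_facet (hb : ∀ x, x ∈ τ ↔ ∀ i, 0 ≤ b.repr x i) (hF : F.IsFaceOf τ)
    {j : Fin k} (hj : b j ∉ F) {z : V} (hz : z ∈ F) : b.repr z j = 0 := by
  have h0 := (hb z).1 (hF.le hz) j
  by_contra hne
  exact hj (basis_mem_of_pos_repr hb hF hz (lt_of_le_of_ne h0 (Ne.symm hne)))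

/-- A vector on the nonnegative side of a facet is moved into the cone by a vector of the facet. -/
lemma exists_mem_facet_add_mem (hb : ∀ x, x ∈ τ ↔ ∀ i, 0 ≤ b.repr x i) {j : Fin k}
    (hj : ∀ i, i ≠ j → b i ∈ F) {z : V} (hz : 0 ≤ b.repr z j) :
    ∃ f ∈ F, z + f ∈ τ := by
  classical
  -- Adding `|z_i|` makes every coordinate except the `j`-th nonnegative and leaves the `j`-th
  -- unchanged.
  refine ⟨∑ i ∈ Finset.univ.erase j, |b.repr z i| • b i, sum_mem fun i hi =>
    F.smul_mem (abs_nonneg _) (hj i (Finset.ne_of_mem_erase hi)), ?_⟩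
  rw [hb]
  intro i
  simp only [map_add, map_sum, map_smul, Finsupp.add_apply, Finsupp.finsetSum_apply,
    Finsupp.smul_apply, b.repr_self, Finsupp.single_apply, smul_eq_mul, mul_ite, mul_one, mul_zero,
    Finset.sum_ite_eq', Finset.mem_erase, Finset.mem_univ, and_true]
  split_ifs with hi
  · linarith [neg_abs_le (b.repr z i)]
  · rw [not_not] at hi
    subst hi
    simpa using hz

lemma span_facet_eq_ker (hb : ∀ x, x ∈ τ ↔ ∀ i, 0 ≤ b.repr x i) (hF : F.IsFaceOf τ)
    {j : Fin k} (hj : b j ∉ F) (hj' : ∀ i, i ≠ j → b i ∈ F) :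
    Submodule.span ℝ (F : Set V) = LinearMap.ker (b.coord j) := by
  refine le_antisymm (Submodule.span_le.2 fun z hz => repr_eq_zero_of_mem_facet hb hF hj hz) ?_
  intro z hz
  rw [← b.sum_repr z]
  refine sum_mem fun i _ => ?_
  by_cases hi : i = j
  · have : b.repr z j = 0 := hz
    rw [hi, this, zero_smul]
    exact zero_mem _
  · exact Submodule.smul_mem _ _ (Submodule.subset_span (hj' i hi))

/-- Provides the dimension `n - 1` demanded of the walls that define the Mori cone. -/
lemma finrank_span_facet (hb : ∀ x, x ∈ τ ↔ ∀ i, 0 ≤ b.repr x i) (hF : F.IsFaceOf τ)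
    {j : Fin k} (hj : b j ∉ F) (hj' : ∀ i, i ≠ j → b i ∈ F) :
    Module.finrank ℝ (Submodule.span ℝ (F : Set V)) + 1 = Module.finrank ℝ V := by
  have : FiniteDimensional ℝ V := b.finiteDimensional_of_finite
  rw [span_facet_eq_ker hb hF hj hj']
  refine Module.Dual.finrank_ker_add_one_of_ne_zero fun h => ?_
  simpa using LinearMap.congr_fun h (b j)

end Orthant

/-! ### Wall relations and local convexity of nef divisors -/

namespace Fan

variable {N : Type*} [AddCommGroup N] {Δ : Fan N}

/-- The numerical class of curves defined by a linear relation `u_ρ = ∑ c_i u_{r_i}` between ray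
generators. -/
def relationClass {k : ℕ} (ρ : Δ.rays) (r : Fin k → Δ.rays) (c : Fin k → ℝ)
    (h : latticePt ρ.1 = ∑ i, c i • latticePt (r i).1) : Δ.N1 :=
  Submodule.liftQ _
    { toFun := fun D => (D ρ : ℝ) - ∑ i, c i * (D (r i) : ℝ)
      map_add' := fun D E => by
        simp only [Pi.add_apply, Int.cast_add, mul_add, Finset.sum_add_distrib]
        ring
      map_smul' := fun a D => by
        simp only [Pi.smul_apply, smul_eq_mul, Int.cast_mul, zsmul_eq_mul, mul_sub, Finset.mul_sum,
          eq_intCast, Int.cast_id]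
        congr 1
        exact Finset.sum_congr rfl fun i _ => by ring }
    (by
      rintro _ ⟨m, rfl⟩
      -- Principal divisors have degree zero because `m` respects the linear relation.
      have := congrArg (realDual m) h
      simp only [map_sum, map_smul, realDual_latticePt, smul_eq_mul] at this
      simp [charDiv, this])

lemma inter_relationClass {k : ℕ} (ρ : Δ.rays) (r : Fin k → Δ.rays) (c : Fin k → ℝ)
    (h : latticePt ρ.1 = ∑ i, c i • latticePt (r i).1) (D : Δ.Div) :
    inter (relationClass ρ r c h) D = (D ρ : ℝ) - ∑ i, c i * (D (r i) : ℝ) := rfl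

lemma ray_eq_of_mem_rayCone [Module.Free ℤ N] {u v : N} (hu : IsPrimitive u) (hv : IsPrimitive v)
    (h : latticePt u ∈ rayCone v) : u = v := by
  obtain ⟨c, hc, h⟩ := mem_hull_singleton_iff.1 h
  exact hu.eq_of_latticePt_eq_smul hv hc h

variable {k : ℕ} {b : Module.Basis (Fin k) ℝ (RealSpace N)} {r : Fin k → Δ.rays}
  {τ F : PointedCone ℝ (RealSpace N)}

/-- A cone of the fan containing a facet of `τ` has no point outside `τ` on the side of `τ`. -/
lemma mem_of_repr_nonneg (hτ : τ ∈ Δ.cones) (hb : ∀ x, x ∈ τ ↔ ∀ i, 0 ≤ b.repr x i)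
    {j : Fin k} (hj : ∀ i, i ≠ j → b i ∈ F) {υ : PointedCone ℝ (RealSpace N)}
    (hυ : υ ∈ Δ.cones) (hFυ : F ≤ υ) {z : RealSpace N} (hz : z ∈ υ) (hzj : 0 ≤ b.repr z j) :
    z ∈ τ := by
  obtain ⟨f, hf, hzf⟩ := exists_mem_facet_add_mem hb hj hzj
  -- The sum `z + f` lies in the common face `υ ⊓ τ`, and both summands lie in `υ`, so `z` lies in
  -- that face.
  exact ((Δ.inf_isFaceOf υ hυ τ hτ).mem_of_add_mem_left hz (hFυ hf)
    ⟨Submodule.add_mem _ hz (hFυ hf), hzf⟩).2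

/-- The only ray on the side of `τ` spanning a cone of the fan with a facet of `τ` is the one
in `τ`. -/
lemma ray_eq_of_repr_nonneg [Module.Free ℤ N] (hτ : τ ∈ Δ.cones) (hr : ∀ i, b i = latticePt (r i).1)
    (hb : ∀ x, x ∈ τ ↔ ∀ i, 0 ≤ b.repr x i) {j : Fin k}
    (hj : ∀ i, i ≠ j → b i ∈ F) {ρ : Δ.rays} (hρ : latticePt ρ.1 ∉ F)
    (hFρ : F ⊔ rayCone ρ.1 ∈ Δ.cones) (h : 0 ≤ b.repr (latticePt ρ.1) j) : ρ = r j := by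
  have hρmem : latticePt ρ.1 ∈ rayCone ρ.1 := Submodule.subset_span rfl
  have hρτ : latticePt ρ.1 ∈ τ := mem_of_repr_nonneg hτ hb hj hFρ le_sup_left
    ((le_sup_right : rayCone ρ.1 ≤ _) hρmem) h
  have hpos : 0 < b.repr (latticePt ρ.1) j := by
    refine lt_of_le_of_ne h fun h0 => hρ ?_
    refine mem_of_basis_mem hb hρτ fun i hi => hj i ?_
    rintro rfl
    exact hi h0.symm
  -- The intersection of `τ` with the ray `ρ` is a face of `τ` containing a point with positive
  -- `j`-th coordinate, so it contains `b j`.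
  have := basis_mem_of_pos_repr hb (Δ.inf_isFaceOf τ hτ _ ρ.2.2) ⟨hρτ, hρmem⟩ hpos
  rw [hr] at this
  exact Subtype.ext (ray_eq_of_mem_rayCone (r j).2.1 ρ.2.1 this.2).symm

lemma facet_sup_rayCone_eq (hr : ∀ i, b i = latticePt (r i).1)
    (hb : ∀ x, x ∈ τ ↔ ∀ i, 0 ≤ b.repr x i) (hFτ : F ≤ τ) {j : Fin k}
    (hj : ∀ i, i ≠ j → b i ∈ F) : F ⊔ rayCone (r j).1 = τ := by
  refine le_antisymm (sup_le hFτ (Submodule.span_le.2 ?_)) fun x hx =>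
    mem_of_basis_mem hb hx fun i _ => ?_
  · rintro _ rfl
    rw [← hr]
    exact basis_mem_of_orthant hb j
  · by_cases hi : i = j
    · subst hi
      rw [hr]
      exact (le_sup_right : rayCone _ ≤ F ⊔ _) (Submodule.subset_span rfl)
    · exact (le_sup_left : F ≤ _) (hj i hi)

/-- The fan axiom makes the smaller cone a face of the larger, and a face of full dimension is
everything. Hence distinct full-dimensional cones meet in a proper face of each. -/
lemma eq_of_le_of_span_eq_top [Module.Free ℤ N] (hs : Δ.IsSimplicial) {τ τ' : PointedCone ℝ (RealSpace N)}
    (hτ : τ ∈ Δ.cones) (hτ' : τ' ∈ Δ.cones)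
    (htop : Submodule.span ℝ (τ : Set (RealSpace N)) = ⊤) (hle : τ ≤ τ') : τ = τ' := by
  have htop' : Submodule.span ℝ (τ' : Set (RealSpace N)) = ⊤ :=
    eq_top_iff.2 (htop ▸ Submodule.span_mono hle)
  obtain ⟨k, r, b, -, hb⟩ := hs.exists_basis hτ' htop'
  refine eq_of_isFaceOf_of_span_eq_top hb ?_ htop
  have := Δ.inf_isFaceOf τ' hτ' τ hτ
  rwa [inf_eq_right.2 hle] at this

/-- Local convexity of the support function of a nef divisor at a wall. -/
lemma IsNef.realDual_le_of_adjacent [Module.Free ℤ N] [Module.Finite ℤ N] (hs : Δ.IsSimplicial) {D : Δ.Div}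
    (hD : IsNef D) {τ τ' : PointedCone ℝ (RealSpace N)} (hτ : τ ∈ Δ.cones) (hτ' : τ' ∈ Δ.cones)
    (htop : Submodule.span ℝ (τ : Set (RealSpace N)) = ⊤)
    (htop' : Submodule.span ℝ (τ' : Set (RealSpace N)) = ⊤) (hne : τ ≠ τ') {x : RealSpace N}
    (hx : Submodule.span ℝ ((τ ⊓ τ' : PointedCone ℝ (RealSpace N)) : Set (RealSpace N)) ⊔
      Submodule.span ℝ {x} = ⊤)
    {m m' : Module.Dual ℤ N} (hm : ∀ ρ : Δ.rays, latticePt ρ.1 ∈ τ → m ρ.1 = -D ρ)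
    (hm' : ∀ ρ : Δ.rays, latticePt ρ.1 ∈ τ' → m' ρ.1 = -D ρ) {z : RealSpace N} (hz : z ∈ τ') :
    realDual m' z ≤ realDual m z := by
  classical
  obtain ⟨k, r, b, hr, hb⟩ := hs.exists_basis hτ htop
  obtain ⟨k', r', b', hr', hb'⟩ := hs.exists_basis hτ' htop'
  have hF := Δ.inf_isFaceOf τ hτ τ' hτ'
  have hF' : (τ ⊓ τ').IsFaceOf τ' := inf_comm τ' τ ▸ Δ.inf_isFaceOf τ' hτ' τ hτ
  have hFne : τ ⊓ τ' ≠ τ := fun h =>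
    hne (eq_of_le_of_span_eq_top hs hτ hτ' htop (inf_eq_left.1 h))
  have hFne' : τ ⊓ τ' ≠ τ' := fun h =>
    hne (eq_of_le_of_span_eq_top hs hτ' hτ htop' (inf_eq_right.1 h)).symm
  have hFΔ : τ ⊓ τ' ∈ Δ.cones := Δ.face_mem τ hτ _ hF
  obtain ⟨j, hj, hjF⟩ := exists_facet_index hb hF hFne hx
  obtain ⟨j', hj', hjF'⟩ := exists_facet_index hb' hF' hFne' hx
  set F := τ ⊓ τ' with hFdef
  -- the generator of `τ'` off the wall lies on the other side
  have hneg : b.repr (b' j') j < 0 := by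
    by_contra! h
    exact hj' ⟨mem_of_repr_nonneg hτ hb hjF hτ' hF'.le (basis_mem_of_orthant hb' j') h,
      basis_mem_of_orthant hb' j'⟩
  -- The `j`-th and `j'`-th coordinates both vanish on the wall, so they are proportional, with
  -- negative factor by `hneg`.
  have hcoord : ∀ z, b.repr z j = b'.repr z j' * b.repr (b' j') j := by
    intro z
    conv_lhs => rw [← b'.sum_repr z]
    rw [map_sum, Finsupp.finsetSum_apply, Finset.sum_eq_single j']
    · simp
    · intro i _ hi
      simp [repr_eq_zero_of_mem_facet hb hF hj (hjF' i hi)]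
    · simp
  -- The wall relation, normalised to have coefficient `1` at the generator of `τ'` off the wall; it
  -- represents the toric curve of `F` up to a positive factor.
  have hrel : latticePt (r' j').1 = ∑ i, b.repr (b' j') i • latticePt (r i).1 := by
    simp only [← hr, ← hr', b.sum_repr]
  let C := relationClass (r' j') r (fun i => b.repr (b' j') i) hrel
  have hCD : ∀ E, inter C E = (E (r' j') : ℝ) - ∑ i, b.repr (b' j') i * (E (r i) : ℝ) :=
    inter_relationClass _ _ _ hrel
  have hCcurve : IsToricCurveMultiple F C := by
    intro ρ hρ
    have hri : ∀ i, r i = ρ → i = j := by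
      rintro i rfl
      by_contra hi
      exact hρ (hr i ▸ hjF i hi)
    have hinter : inter C (primeDiv ρ) =
        (if r' j' = ρ then 1 else 0) - b.repr (b' j') j * (if r j = ρ then 1 else 0) := by
      rw [hCD, Finset.sum_eq_single j]
      · simp [primeDiv, Pi.single_apply]
      · intro i _ hi
        have : r i ≠ ρ := fun h => hi (hri i h)
        simp [primeDiv, this]
      · simp
    rw [hinter]
    constructor
    · intro hρF
      have : r j = ρ ∨ r' j' = ρ := by
        rcases le_total 0 (b.repr (latticePt ρ.1) j) with h | h
        · exact Or.inl (ray_eq_of_repr_nonneg hτ hr hb hjF hρ hρF h).symm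
        · refine Or.inr (ray_eq_of_repr_nonneg hτ' hr' hb' hjF' hρ hρF ?_).symm
          rw [hcoord] at h
          by_contra! h'
          have := mul_pos_of_neg_of_neg h' hneg
          linarith
      split_ifs <;> first | linarith | tauto
    · intro hρF
      have h1 : r j ≠ ρ := by
        rintro rfl
        exact hρF (facet_sup_rayCone_eq hr hb hF.le hjF ▸ hτ)
      have h2 : r' j' ≠ ρ := by
        rintro rfl
        exact hρF (facet_sup_rayCone_eq hr' hb' hF'.le hjF' ▸ hτ')
      simp [h1, h2]
  have hnonneg : 0 ≤ inter C D := hD C (Submodule.subset_span ⟨F, hFΔ, by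
    rw [coneDim, finrank_span_facet hb hF hj hjF, Module.finrank_baseChange], hCcurve⟩)
  have hDr : ∀ i, (D (r i) : ℝ) = -realDual m (b i) := by
    intro i
    rw [hr, realDual_latticePt, hm (r i) (hr i ▸ basis_mem_of_orthant hb i)]
    simp
  have hDr' : ∀ i, (D (r' i) : ℝ) = -realDual m' (b' i) := by
    intro i
    rw [hr', realDual_latticePt, hm' (r' i) (hr' i ▸ basis_mem_of_orthant hb' i)]
    simp
  -- On the generators of the wall both equations take the value `-D`; at the remaining generator of
  -- `τ'` the inequality is `0 ≤ C · D`.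
  have hgen : ∀ i, realDual m' (b' i) ≤ realDual m (b' i) := by
    intro i
    by_cases hi : i = j'
    · subst hi
      rw [hCD, hDr'] at hnonneg
      simp only [hDr] at hnonneg
      have : realDual m (b' i) = ∑ l, b.repr (b' i) l * realDual m (b l) := by
        have := congrArg (realDual m) (b.sum_repr (b' i))
        simp only [map_sum, map_smul, smul_eq_mul] at this
        exact this.symm
      rw [this]
      simp only [mul_neg, Finset.sum_neg_distrib] at hnonneg
      linarith
    · have hmem := (hF.le (hjF' i hi))
      rw [hr'] at hmem
      rw [hr' i, realDual_latticePt, realDual_latticePt, hm (r' i) hmem,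
        hm' (r' i) (hr' i ▸ basis_mem_of_orthant hb' i)]
  rw [← b'.sum_repr z]
  simp only [map_sum, map_smul, smul_eq_mul]
  exact Finset.sum_le_sum fun i _ => mul_le_mul_of_nonneg_left (hgen i) ((hb' z).1 hz i)

end Fan

/-! ### Generic points of a cone -/

section Generic

variable {V : Type*} [AddCommGroup V] [Module ℝ V]

lemma exists_eq_sub_of_mem_span (σ : PointedCone ℝ V) {z : V}
    (hz : z ∈ Submodule.span ℝ (σ : Set V)) : ∃ x ∈ σ, ∃ y ∈ σ, z = x - y := by
  induction hz using Submodule.span_induction with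
  | mem x hx => exact ⟨x, hx, 0, zero_mem σ, by simp⟩
  | zero => exact ⟨0, zero_mem σ, 0, zero_mem σ, by simp⟩
  | add u v _ _ hu hv =>
    obtain ⟨x, hx, y, hy, rfl⟩ := hu
    obtain ⟨x', hx', y', hy', rfl⟩ := hv
    exact ⟨x + x', add_mem hx hx', y + y', add_mem hy hy', by abel⟩
  | smul a u _ hu =>
    obtain ⟨x, hx, y, hy, rfl⟩ := hu
    rcases le_total 0 a with ha | ha
    · exact ⟨a • x, σ.smul_mem ha hx, a • y, σ.smul_mem ha hy, smul_sub _ _ _⟩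
    · exact ⟨-a • y, σ.smul_mem (by linarith) hy, -a • x, σ.smul_mem (by linarith) hx, by
        rw [smul_sub, neg_smul, neg_smul]; abel⟩

/-- A cone spanning the space is not covered by finitely many proper subspaces. -/
lemma exists_mem_cone_forall_notMem {σ : PointedCone ℝ V}
    (hσ : Submodule.span ℝ (σ : Set V) = ⊤) {S : Set (Submodule ℝ V)} (hS : S.Finite)
    (htop : ⊤ ∉ S) : ∃ y ∈ σ, ∀ H ∈ S, y ∉ H := by
  obtain ⟨z, hz⟩ : ∃ z, ∀ H ∈ S, z ∉ H := by
    have := Subspace.biUnion_ne_univ_of_top_notMem (s := hS.toFinset) (by simpa using htop)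
    rw [Set.ne_univ_iff_exists_notMem] at this
    simpa using this
  obtain ⟨x, hx, y, hy, rfl⟩ := exists_eq_sub_of_mem_span σ (z := z) (hσ ▸ Submodule.mem_top)
  -- Each `H` contains `x + n • y` for at most one `n`: two such values would put `x`, `y`, and
  -- hence `z = x - y`, in `H`.
  have hfin : (⋃ H ∈ S, {n : ℕ | x + (n : ℝ) • y ∈ H}).Finite := by
    refine hS.biUnion fun H hH => Set.Subsingleton.finite fun n hn l hl => ?_
    by_contra hne
    have hnl : ((n : ℝ) - l) ≠ 0 := sub_ne_zero.2 (by exact_mod_cast hne)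
    have h1 : ((n : ℝ) - l) • y ∈ H := by
      have := H.sub_mem hn hl
      rwa [add_sub_add_left_eq_sub, ← sub_smul] at this
    have hyH : y ∈ H := (H.smul_mem_iff hnl).1 h1
    have hxH : x ∈ H := (H.add_mem_iff_left (H.smul_mem _ hyH)).1 hn
    exact hz H hH (H.sub_mem hxH hyH)
  obtain ⟨n, hn⟩ := hfin.exists_notMem
  refine ⟨x + (n : ℝ) • y, add_mem hx (σ.smul_mem n.cast_nonneg hy), fun H hH h => hn ?_⟩
  simp only [Set.mem_iUnion]
  exact ⟨H, hH, h⟩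

end Generic

/-! ### Global convexity: local equations lie in the polytope -/

namespace Fan

variable {N : Type*} [AddCommGroup N] [Module.Free ℤ N] {Δ : Fan N}

/-- A line through `w` that lies in no proper subspace spanned by a cone runs, just after `w`,
inside a full-dimensional cone. -/
lemma exists_cone_of_line (hc : Δ.IsComplete) (hs : Δ.IsSimplicial) {w d : RealSpace N}
    (hwd : ∀ G ∈ Δ.cones, w ∈ Submodule.span ℝ (G : Set (RealSpace N)) →
      d ∈ Submodule.span ℝ (G : Set (RealSpace N)) →
      Submodule.span ℝ (G : Set (RealSpace N)) = ⊤) {ε : ℝ} (hε : 0 < ε) :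
    ∃ τ ∈ Δ.cones, Submodule.span ℝ (τ : Set (RealSpace N)) = ⊤ ∧ w ∈ τ ∧
      ∃ s, 0 < s ∧ s ≤ ε ∧ w + s • d ∈ τ := by
  -- The sample points converge to `w`; with finitely many cones, a single one contains infinitely
  -- many of them. Two of these put `w` and `d` in its span, and closedness then puts `w` in it.
  choose f hfΔ hf using fun n : ℕ => hc (w + (ε / (n + 1)) • d)
  have : Finite Δ.cones := Δ.finite
  obtain ⟨⟨τ, hτ⟩, hinf⟩ := Finite.exists_infinite_fiber
    (fun n => (⟨f n, hfΔ n⟩ : Δ.cones))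
  rw [Set.infinite_coe_iff] at hinf
  have hmem : ∀ n ∈ (fun n => (⟨f n, hfΔ n⟩ : Δ.cones)) ⁻¹' {⟨τ, hτ⟩},
      w + (ε / (n + 1)) • d ∈ τ := by
    intro n hn
    have : f n = τ := congrArg Subtype.val hn
    exact this ▸ hf n
  obtain ⟨n, hn⟩ := hinf.nonempty
  obtain ⟨l, hl, hnl⟩ := hinf.exists_gt n
  have htop : Submodule.span ℝ (τ : Set (RealSpace N)) = ⊤ := by
    have h1 := Submodule.subset_span (R := ℝ) (hmem n hn)
    have h2 := Submodule.subset_span (R := ℝ) (hmem l hl)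
    have hlt : ε / (l + 1 : ℝ) < ε / (n + 1) := by
      have : (n : ℝ) < l := by exact_mod_cast hnl
      gcongr
    have hd : d ∈ Submodule.span ℝ (τ : Set (RealSpace N)) := by
      have := Submodule.sub_mem _ h1 h2
      rw [add_sub_add_left_eq_sub, ← sub_smul] at this
      exact (Submodule.smul_mem_iff _ (sub_ne_zero.2 hlt.ne')).1 this
    exact hwd τ hτ ((Submodule.add_mem_iff_left _ (Submodule.smul_mem _ _ hd)).1 h1) hd
  obtain ⟨k, r, b, -, hb⟩ := hs.exists_basis hτ htop
  refine ⟨τ, hτ, htop, (hb w).2 fun i => ?_, ε / (n + 1), by positivity,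
    div_le_self hε.le (by linarith [n.cast_nonneg (α := ℝ)]), hmem n hn⟩
  by_contra! hneg
  obtain ⟨q, hq⟩ := exists_nat_gt (ε * |b.repr d i| / -b.repr w i)
  obtain ⟨l, hl, hql⟩ := hinf.exists_gt q
  have h1 := (hb _).1 (hmem l hl) i
  simp only [map_add, map_smul, Finsupp.add_apply, Finsupp.smul_apply, smul_eq_mul] at h1
  have hl0 : (0 : ℝ) < l + 1 := by positivity
  have hql' : (q : ℝ) < l := by exact_mod_cast hql
  rw [div_lt_iff₀ (by linarith)] at hq
  have h2 : ε / (l + 1) * b.repr d i ≤ ε * |b.repr d i| / (l + 1) := by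
    rw [div_mul_eq_mul_div]
    gcongr
    exact le_abs_self _
  have h3 : ε * |b.repr d i| / (l + 1) < -b.repr w i := by
    rw [div_lt_iff₀ hl0]
    nlinarith
  linarith

/-- On a complete simplicial fan every point lies in a full-dimensional cone. -/
lemma exists_cone_span_eq_top (hc : Δ.IsComplete) (hs : Δ.IsSimplicial) (w : RealSpace N) :
    ∃ τ ∈ Δ.cones, Submodule.span ℝ (τ : Set (RealSpace N)) = ⊤ ∧ w ∈ τ := by
  obtain ⟨d, -, hd⟩ := exists_mem_cone_forall_notMem (σ := (⊤ : PointedCone ℝ (RealSpace N)))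
    (S := (fun G : PointedCone ℝ (RealSpace N) =>
      Submodule.span ℝ (G : Set (RealSpace N))) '' Δ.cones \ {⊤})
    (by simp) ((Δ.finite.image _).sdiff) (by simp)
  obtain ⟨τ, hτ, htop, hw, -⟩ := exists_cone_of_line hc hs (w := w) (d := d)
    (fun G hG _ hdG => by
      by_contra hne
      exact hd _ ⟨⟨G, hG, rfl⟩, hne⟩ hdG) one_pos
  exact ⟨τ, hτ, htop, hw⟩

/-- The local equations of a nef Cartier divisor on the full-dimensional cones are lattice points
of its polytope. -/
lemma IsNef.exists_local_equation [Module.Finite ℤ N] (hc : Δ.IsComplete) (hs : Δ.IsSimplicial)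
    {D : Δ.Div} (hCartier : IsCartier D) (hD : IsNef D) {σ : PointedCone ℝ (RealSpace N)}
    (hσ : σ ∈ Δ.cones) (hσtop : Submodule.span ℝ (σ : Set (RealSpace N)) = ⊤) :
    ∃ m : Module.Dual ℤ N, (∀ ρ : Δ.rays, latticePt ρ.1 ∈ σ → m ρ.1 = -D ρ) ∧
      realDual m ∈ polytope D := by
  -- The value `0` off the fan only serves to make the choice `μ` total.
  have : ∀ τ, ∃ m : Module.Dual ℤ N, τ ∈ Δ.cones → ∀ ρ : Δ.rays, latticePt ρ.1 ∈ τ →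
      m ρ.1 = -D ρ := by
    intro τ
    by_cases hτ : τ ∈ Δ.cones
    · exact (hCartier τ hτ).imp fun m hm _ => hm
    · exact ⟨0, fun h => absurd h hτ⟩
  choose μ hμ using this
  refine ⟨μ σ, hμ σ hσ, fun ρ => ?_⟩
  set x := latticePt ρ.1 with hx
  let sp : PointedCone ℝ (RealSpace N) → Submodule ℝ (RealSpace N) :=
    fun G => Submodule.span ℝ (G : Set (RealSpace N))
  -- Avoiding the proper subspaces `sp G` makes the line generic; avoiding the proper subspaces `sp
  -- G ⊔ span {x}` ensures that, before reaching `x`, the segment passes between distinct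
  -- full-dimensional cones only through walls.
  obtain ⟨y, hyσ, hy⟩ := exists_mem_cone_forall_notMem hσtop
    (S := (sp '' Δ.cones ∪ (fun G => sp G ⊔ Submodule.span ℝ {x}) '' Δ.cones) \ {⊤})
    ((Δ.finite.image _).union (Δ.finite.image _)).sdiff (by simp)
  have hy1 : ∀ G ∈ Δ.cones, y ∈ sp G → sp G = ⊤ := by
    intro G hG hyG
    by_contra hne
    exact hy _ ⟨Or.inl ⟨G, hG, rfl⟩, hne⟩ hyG
  have hy2 : ∀ G ∈ Δ.cones, y ∈ sp G ⊔ Submodule.span ℝ {x} →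
      sp G ⊔ Submodule.span ℝ {x} = ⊤ := by
    intro G hG hyG
    by_contra hne
    exact hy _ ⟨Or.inr ⟨G, hG, rfl⟩, hne⟩ hyG
  set d := x - y with hd
  let φ : PointedCone ℝ (RealSpace N) → Module.Dual ℝ (RealSpace N) := fun τ => realDual (μ τ)
  -- parameters at which the segment from `y` to `x` is in a cone whose local equation is
  -- dominated, from there on, by the one on `σ`
  let T : Set ℝ := Set.Icc 0 1 ∩ ⋃ τ ∈ {τ ∈ Δ.cones | sp τ = ⊤},
    {t | y + t • d ∈ τ ∧ φ τ (y + t • d) ≤ φ σ (y + t • d) ∧ φ τ d ≤ φ σ d}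
  have hTmem : ∀ t, t ∈ T ↔ t ∈ Set.Icc (0 : ℝ) 1 ∧ ∃ τ, (τ ∈ Δ.cones ∧ sp τ = ⊤) ∧
      y + t • d ∈ τ ∧ φ τ (y + t • d) ≤ φ σ (y + t • d) ∧ φ τ d ≤ φ σ d := by
    intro t
    simp only [T, Set.mem_inter_iff, Set.mem_iUnion, Set.mem_ofPred_eq, exists_prop]
  have hTcompact : IsCompact T := by
    refine isCompact_Icc.inter_right (Set.Finite.isClosed_biUnion
      (Δ.finite.subset fun τ h => h.1) fun τ hτ => ?_)
    obtain ⟨k, r, b, -, hb⟩ := hs.exists_basis hτ.1 hτ.2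
    simp only [hb, Set.ofPred_and, Set.ofPred_forall, map_add, map_smul, Finsupp.add_apply,
      Finsupp.smul_apply, smul_eq_mul]
    refine IsClosed.inter (isClosed_iInter fun i => ?_) (IsClosed.inter ?_ isClosed_const)
    · exact isClosed_le (by fun_prop) (by fun_prop)
    · exact isClosed_le (by fun_prop) (by fun_prop)
  have hT0 : (0 : ℝ) ∈ T := by
    rw [hTmem]
    exact ⟨by simp, σ, ⟨hσ, hσtop⟩, by simpa using hyσ, le_rfl, le_rfl⟩
  obtain ⟨t, htT, htmax⟩ := hTcompact.exists_isGreatest ⟨0, hT0⟩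
  obtain ⟨⟨ht0, ht1⟩, τ, ⟨hτ, hτtop⟩, hmem, hle, hslope⟩ := (hTmem t).1 htT
  rcases eq_or_lt_of_le ht1 with rfl | hlt
  · have hp : y + (1 : ℝ) • d = x := by rw [hd]; module
    rw [hp] at hmem hle
    have := hμ τ hτ ρ hmem
    have h1 : φ τ x = -(D ρ : ℝ) := by
      simp only [φ, hx, realDual_latticePt, this]
      simp
    linarith
  -- If the largest parameter `t` were below `1`, the domination would persist into the next cone
  -- `τ'`, contradicting maximality.
  · exfalso
    set w := y + t • d with hw
    have hyw : y = w - t • d := by rw [hw]; abel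
    obtain ⟨τ', hτ', hτ'top, hwτ', s, hs0, hs1, hsτ'⟩ := exists_cone_of_line hc hs (w := w) (d := d)
      (fun G hG h1 h2 => hy1 G hG (by
        rw [hyw]; exact Submodule.sub_mem _ h1 (Submodule.smul_mem _ _ h2)))
      (sub_pos.2 hlt)
    have hp : y + (t + s) • d = w + s • d := by rw [hw]; module
    have hadj : φ τ' w ≤ φ τ w ∧ φ τ w ≤ φ τ' w ∧ φ τ' (w + s • d) ≤ φ τ (w + s • d) := by
      by_cases hne : τ = τ'
      · subst hne
        exact ⟨le_rfl, le_rfl, le_rfl⟩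
      · have hF : τ ⊓ τ' ∈ Δ.cones := Δ.face_mem τ hτ _ (Δ.inf_isFaceOf τ hτ τ' hτ')
        have hwall := hy2 _ hF (by
          -- Since `t < 1`, the point `y` is a combination of `w` and `x`, so its genericity applies
          -- to the span of `τ ⊓ τ'` and `x`.
          have hy' : y = (1 - t)⁻¹ • (w - t • x) := by
            rw [eq_inv_smul_iff₀ (by linarith), hw, hd]
            module
          rw [hy']
          refine Submodule.smul_mem _ _ (Submodule.sub_mem _ ?_ ?_)
          · exact Submodule.mem_sup_left (Submodule.subset_span ⟨hmem, hwτ'⟩)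
          · exact Submodule.mem_sup_right (Submodule.smul_mem _ _
              (Submodule.mem_span_singleton_self x)))
        refine ⟨?_, ?_, ?_⟩
        · exact hD.realDual_le_of_adjacent hs hτ hτ' hτtop hτ'top hne hwall (hμ τ hτ) (hμ τ' hτ')
            hwτ'
        · refine hD.realDual_le_of_adjacent hs hτ' hτ hτ'top hτtop (Ne.symm hne) (x := x) ?_
            (hμ τ' hτ') (hμ τ hτ) hmem
          rw [inf_comm]
          exact hwall
        · exact hD.realDual_le_of_adjacent hs hτ hτ' hτtop hτ'top hne hwall (hμ τ hτ) (hμ τ' hτ')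
            hsτ'
    obtain ⟨h1, h2, h3⟩ := hadj
    -- The two equations agree at `w`, so the inequality just after `w` is one between slopes.
    have hslope' : φ τ' d ≤ φ σ d := by
      simp only [map_add, map_smul, smul_eq_mul] at h3
      have : s * φ τ' d ≤ s * φ τ d := by linarith
      exact (le_of_mul_le_mul_left this hs0).trans hslope
    have : t + s ∈ T := by
      rw [hTmem, hp]
      refine ⟨⟨by linarith, by linarith⟩, τ', ⟨hτ', hτ'top⟩, hsτ', ?_, hslope'⟩
      have h4 : ∀ υ, φ υ (w + s • d) = φ υ w + s * φ υ d := fun υ => by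
        rw [map_add, map_smul, smul_eq_mul]
      rw [h4, h4]
      have := mul_le_mul_of_nonneg_left hslope' hs0.le
      linarith
    have := htmax this
    linarith

end Fan

/-! ### Comparison of real spaces and quotients -/

/-- The isomorphism of real spaces induced by an isomorphism of lattices. -/
def realEquiv {N N' : Type*} [AddCommGroup N] [AddCommGroup N'] (e : N ≃ₗ[ℤ] N') :
    RealSpace N ≃ₗ[ℝ] RealSpace N' :=
  LinearEquiv.baseChange ℤ ℝ N N' e

@[simp] lemma realEquiv_latticePt {N N' : Type*} [AddCommGroup N] [AddCommGroup N']
    (e : N ≃ₗ[ℤ] N') (u : N) : realEquiv e (latticePt u) = latticePt (e u) := by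
  simp [realEquiv, latticePt]

lemma linearMap_ext_latticePt {N V : Type*} [AddCommGroup N] [AddCommGroup V] [Module ℝ V]
    {f g : RealSpace N →ₗ[ℝ] V} (h : ∀ u : N, f (latticePt u) = g (latticePt u)) : f = g :=
  LinearMap.ext_on_range span_range_latticePt h

/-- The normal cones are preimages of their images in the quotient by the minimal cone. -/
lemma mem_normalCone_of_mkQ_mem {N : Type*} [AddCommGroup N]
    {P : Set (Module.Dual ℝ (RealSpace N))} {v : Module.Dual ℝ (RealSpace N)} (hv : v ∈ P)
    {x : RealSpace N}
    (hx : (minimalLattice P).mkQ.baseChange ℝ x ∈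
      (normalCone P v).map ((minimalLattice P).mkQ.baseChange ℝ)) : x ∈ normalCone P v := by
  obtain ⟨y, hy, hxy⟩ := hx
  intro m hm
  -- The form `m - v` vanishes on the minimal lattice and descends to the quotient, so its value at
  -- `x` depends only on the image of `x`.
  let l : N →ₗ[ℤ] ℝ := ((m - v).restrictScalars ℤ) ∘ₗ TensorProduct.mk ℤ ℝ N 1
  have hl : ∀ u, l u = (m - v) (latticePt u) := fun u => rfl
  let g : RealSpace (QuotLattice P) →ₗ[ℝ] ℝ :=
    LinearMap.liftBaseChange ℝ ((minimalLattice P).liftQ l fun u hu => by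
      rw [LinearMap.mem_ker, hl, LinearMap.sub_apply, sub_eq_zero]
      exact hu m hm v hv)
  have hg : g ∘ₗ (minimalLattice P).mkQ.baseChange ℝ = m - v := by
    refine linearMap_ext_latticePt fun u => ?_
    rw [LinearMap.comp_apply, baseChange_latticePt, ← hl]
    simp [g, latticePt]
  have h1 : ∀ z, g ((minimalLattice P).mkQ.baseChange ℝ z) = m z - v z := fun z =>
    LinearMap.congr_fun hg z
  have h2 : m x - v x = m y - v y := by
    rw [← h1, ← h1]
    exact congrArg g hxy.symm
  have h3 := hy m hm
  linarith

/-! ### Strict transforms, pulled-back curves and redundant inequalities -/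

namespace BirationalContraction

variable {N N' : Type*} [AddCommGroup N] [AddCommGroup N'] {Δ : Fan N} {Δ' : Fan N'}
  (ξ : BirationalContraction Δ Δ')

lemma realEquiv_rayPreimage (ρ : Δ'.rays) :
    realEquiv ξ.toEquiv (latticePt (ξ.rayPreimage ρ).1) = latticePt ρ.1 := by
  simp [rayPreimage]

lemma rayPreimage_injective : Function.Injective ξ.rayPreimage := by
  intro ρ ρ' h
  exact Subtype.ext (ξ.toEquiv.symm.injective (congrArg Subtype.val h))

lemma pushDiv_primeDiv_rayPreimage (ρ : Δ'.rays) :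
    ξ.pushDiv (Fan.primeDiv (ξ.rayPreimage ρ)) = Fan.primeDiv ρ := by
  classical
  ext ρ'
  change Fan.primeDiv (ξ.rayPreimage ρ) (ξ.rayPreimage ρ') = _
  simp [Fan.primeDiv, Pi.single_apply, ξ.rayPreimage_injective.eq_iff]

lemma pushDiv_primeDiv_of_notMem_range {ρ : Δ.rays} (h : ρ ∉ Set.range ξ.rayPreimage) :
    ξ.pushDiv (Fan.primeDiv ρ) = 0 := by
  classical
  ext ρ'
  change Fan.primeDiv ρ (ξ.rayPreimage ρ') = _
  have : ξ.rayPreimage ρ' ≠ ρ := fun h' => h ⟨ρ', h'⟩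
  simp [Fan.primeDiv, this]

/-- Pull-back of numerical classes of curves, dual to the push-forward of divisors. -/
def pullCurve (C : Δ'.N1) : Δ.N1 := C ∘ₗ ξ.pushClass

lemma inter_pullCurve (C : Δ'.N1) (D : Δ.Div) :
    Fan.inter (ξ.pullCurve C) D = Fan.inter C (ξ.pushDiv D) := rfl

/-- Contracted rays push forward to `0`, hence have intersection number `0` with a pulled-back
class. -/
lemma exists_rayPreimage_of_mem_J {C : Δ'.N1} {ρ : Δ.rays} (h : ρ ∈ Fan.J (ξ.pullCurve C)) :
    ∃ ρ' ∈ Fan.J C, ξ.rayPreimage ρ' = ρ := by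
  by_cases hρ : ρ ∈ Set.range ξ.rayPreimage
  · obtain ⟨ρ', rfl⟩ := hρ
    refine ⟨ρ', ?_, rfl⟩
    rwa [Fan.J, Set.mem_ofPred_eq, inter_pullCurve, pushDiv_primeDiv_rayPreimage] at h
  · rw [Fan.J, Set.mem_ofPred_eq, inter_pullCurve, ξ.pushDiv_primeDiv_of_notMem_range hρ] at h
    exact absurd (map_zero C) h

/-- If `ξ` is over `X_{Δ̄_[D]}`, each cone of `Δ'` lies in a cone of the normal fan of `P_D`. -/
lemma IsOver.exists_normalCone {ξ : BirationalContraction Δ Δ'} {D : Δ.Div} (h : ξ.IsOver D)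
    {σ' : PointedCone ℝ (RealSpace N')} (hσ' : σ' ∈ Δ'.cones) :
    ∃ v ∈ Fan.polytope D, ∀ x, realEquiv ξ.toEquiv x ∈ σ' →
      x ∈ normalCone (Fan.polytope D) v := by
  obtain ⟨φ', hφ', hcomp⟩ := h
  obtain ⟨_, ⟨_, ⟨v, hv, rfl⟩, rfl⟩, hle⟩ := hφ' σ' hσ'
  refine ⟨v, hv, fun x hx => mem_normalCone_of_mkQ_mem hv (hle ⟨_, hx, ?_⟩)⟩
  have : φ'.baseChange ℝ ∘ₗ (realEquiv ξ.toEquiv).toLinearMap =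
      (minimalLattice (Fan.polytope D)).mkQ.baseChange ℝ := by
    refine linearMap_ext_latticePt fun u => ?_
    rw [← hcomp]
    simp
  exact LinearMap.congr_fun this x

variable [Module.Free ℤ N] [Module.Finite ℤ N] [Module.Free ℤ N']

/-- For a contraction over `X_{Δ̄_[D]}` the inequalities of the rays contracted by `ξ` are
redundant in the definition of `P_D`. -/
lemma IsOver.mem_polytope {ξ : BirationalContraction Δ Δ'} {D : Δ.Div} (h : ξ.IsOver D)
    (hc : Δ.IsComplete) (hs : Δ.IsSimplicial) (hc' : Δ'.IsComplete) (hs' : Δ'.IsSimplicial)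
    (hCartier : Fan.IsCartier D) (hNef : Fan.IsNef D) {m : Module.Dual ℝ (RealSpace N)}
    (hm : ∀ ρ : Δ'.rays, -(D (ξ.rayPreimage ρ) : ℝ) ≤ m (latticePt (ξ.rayPreimage ρ).1)) :
    m ∈ Fan.polytope D := by
  intro ρ
  obtain ⟨σ', hσ', hρσ'⟩ := hc' (realEquiv ξ.toEquiv (latticePt ρ.1))
  obtain ⟨v, hv, hσv⟩ := h.exists_normalCone hσ'
  obtain ⟨k, r, -, hr⟩ := hs'.exists_rays hσ'
  have hrv : ∀ i, v (latticePt (ξ.rayPreimage (r i)).1) ≤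
      m (latticePt (ξ.rayPreimage (r i)).1) := by
    intro i
    refine le_trans ?_ (hm (r i))
    obtain ⟨τ, hτ, hτtop, hmem⟩ := Fan.exists_cone_span_eq_top hc hs
      (latticePt (ξ.rayPreimage (r i)).1)
    obtain ⟨n, hn, hnP⟩ := hNef.exists_local_equation hc hs hCartier hτ hτtop
    -- The local equation `n` is a point of `P_D` with value `-D` at this generator, while `v` is
    -- minimal there.
    have h1 := hσv (latticePt (ξ.rayPreimage (r i)).1) (by
      rw [realEquiv_rayPreimage, hr]
      exact Submodule.subset_span ⟨i, rfl⟩) _ hnP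
    rw [realDual_latticePt, hn _ hmem] at h1
    exact_mod_cast h1
  rw [hr, mem_hull_range_iff] at hρσ'
  obtain ⟨c, hc0, hρ⟩ := hρσ'
  have hρ' : latticePt ρ.1 = ∑ i, c i • latticePt (ξ.rayPreimage (r i)).1 := by
    apply (realEquiv ξ.toEquiv).injective
    rw [hρ, map_sum]
    simp only [map_smul, realEquiv_rayPreimage]
  refine (hv ρ).trans ?_
  rw [hρ']
  simp only [map_sum, map_smul, smul_eq_mul]
  exact Finset.sum_le_sum fun i _ => mul_le_mul_of_nonneg_left (hrv i) (hc0 i)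

end BirationalContraction

/-! ### Transport of normal cones, and the main theorem -/

lemma coneDim_map_realEquiv {N N' : Type*} [AddCommGroup N] [AddCommGroup N'] (e : N ≃ₗ[ℤ] N')
    (σ : PointedCone ℝ (RealSpace N)) :
    coneDim (σ.map (realEquiv e).toLinearMap) = coneDim σ := by
  rw [coneDim, coneDim, PointedCone.coe_map, Submodule.span_image]
  exact LinearEquiv.finrank_map_eq (realEquiv e) _

/-- Normal cones of two polytopes that differ by an isomorphism of lattices and a translation. -/
lemma normalCone_eq_map {N N' : Type*} [AddCommGroup N] [AddCommGroup N'] (e : N ≃ₗ[ℤ] N')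
    {P : Set (Module.Dual ℝ (RealSpace N))} {P' : Set (Module.Dual ℝ (RealSpace N'))}
    (t : Module.Dual ℝ (RealSpace N'))
    (h : ∀ m', m' ∈ P' ↔ (m' + t) ∘ₗ (realEquiv e).toLinearMap ∈ P)
    (v' : Module.Dual ℝ (RealSpace N')) :
    normalCone P' v' = (normalCone P ((v' + t) ∘ₗ (realEquiv e).toLinearMap)).map
      (realEquiv e).toLinearMap := by
  ext y
  constructor
  · intro hy
    refine ⟨(realEquiv e).symm y, fun m hm => ?_, by simp⟩
    have h1 := hy (m ∘ₗ (realEquiv e).symm.toLinearMap - t) (by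
      rw [h, sub_add_cancel, LinearMap.comp_assoc]
      simpa using hm)
    simp only [LinearMap.sub_apply, LinearMap.comp_apply, LinearEquiv.coe_coe] at h1
    simp only [LinearMap.add_apply, LinearMap.comp_apply, LinearEquiv.coe_coe,
      LinearEquiv.apply_symm_apply]
    linarith
  · rintro ⟨x, hx, rfl⟩ m' hm'
    have h1 := hx _ ((h m').1 hm')
    simpa using h1

end Toric

end

/-- Let `ξ : X_Δ ⇢ X_Δ'` be a toric birational contraction over `X_{Δ̄_[D]}` between complete
simplicial toric varieties, `D` nef and Cartier. If `ξ_*[D]` has global low toric degree, then so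
has `[D]`. -/
theorem proposition4p11 {N N' : Type*} [AddCommGroup N] [Module.Free ℤ N] [Module.Finite ℤ N]
    [AddCommGroup N'] [Module.Free ℤ N'] [Module.Finite ℤ N']
    (Δ : Toric.Fan N) (Δ' : Toric.Fan N')
    (hc : Δ.IsComplete) (hs : Δ.IsSimplicial) (hc' : Δ'.IsComplete) (hs' : Δ'.IsSimplicial)
    (D : Δ.Div) (hCartier : Toric.Fan.IsCartier D) (hNef : Toric.Fan.IsNef D)
    (ξ : Toric.BirationalContraction Δ Δ') (hξ : ξ.IsOver D)
    (D' : Δ'.Div) (hD' : Toric.Fan.divClass D' = ξ.pushClass (Toric.Fan.divClass D))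
    (h : Toric.Fan.HasGlobalLowToricDegree D') :
    Toric.Fan.HasGlobalLowToricDegree D := by
  classical
  obtain ⟨C, I, hCrat, hIpos, hIcard, hdeg, hcones⟩ := h
  have hprime : ∀ ρ, Toric.Fan.inter (ξ.pullCurve C) (Toric.Fan.primeDiv (ξ.rayPreimage ρ)) =
      Toric.Fan.inter C (Toric.Fan.primeDiv ρ) := fun ρ => by
    rw [ξ.inter_pullCurve, ξ.pushDiv_primeDiv_rayPreimage]
  have hCD : Toric.Fan.inter (ξ.pullCurve C) D = Toric.Fan.inter C D' :=
    (congrArg C hD').symm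
  -- Equality of classes gives a character `m₀`, by which the polytopes are translated.
  obtain ⟨m₀, hm₀⟩ : ∃ m₀, Δ'.charDiv m₀ = D' - ξ.pushDiv D :=
    (Submodule.Quotient.eq _).1 hD'
  have hDρ : ∀ ρ, D' ρ = D (ξ.rayPreimage ρ) + m₀ ρ.1 := fun ρ => by
    have h1 : m₀ ρ.1 = D' ρ - D (ξ.rayPreimage ρ) := congrFun hm₀ ρ
    rw [h1]
    ring
  have hP : ∀ m', m' ∈ Toric.Fan.polytope D' ↔
      (m' + Toric.realDual m₀) ∘ₗ (Toric.realEquiv ξ.toEquiv).toLinearMap ∈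
        Toric.Fan.polytope D := by
    have key : ∀ (m' : Module.Dual ℝ (Toric.RealSpace N')) (ρ : Δ'.rays),
        -(D' ρ : ℝ) ≤ m' (Toric.latticePt ρ.1) ↔ -(D (ξ.rayPreimage ρ) : ℝ) ≤
        ((m' + Toric.realDual m₀) ∘ₗ (Toric.realEquiv ξ.toEquiv).toLinearMap)
          (Toric.latticePt (ξ.rayPreimage ρ).1) := by
      intro m' ρ
      rw [LinearMap.comp_apply, LinearEquiv.coe_coe, ξ.realEquiv_rayPreimage,
        LinearMap.add_apply, Toric.realDual_latticePt, hDρ]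
      push_cast
      constructor <;> intro <;> linarith
    intro m'
    -- Forward is the redundancy of the contracted rays; backward merely forgets their inequalities.
    exact ⟨fun hm' => hξ.mem_polytope hc hs hc' hs' hCartier hNef fun ρ => (key m' ρ).1 (hm' ρ),
      fun hm ρ => (key m' ρ).2 (hm _)⟩
  refine ⟨ξ.pullCurve C, I.map ⟨ξ.rayPreimage, ξ.rayPreimage_injective⟩,
    fun E => hCrat (ξ.pushDiv E), ?_, by simpa using hIcard, ?_, ?_⟩
  · intro ρ hρ
    obtain ⟨ρ', hρ', rfl⟩ := Finset.mem_map.1 hρ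
    exact (hIpos hρ').trans_eq (hprime ρ').symm
  · rw [hCD, Finset.sum_map]
    simpa only [Function.Embedding.coeFn_mk, hprime] using hdeg
  · intro ρ hρ
    obtain ⟨ρ', hρ', rfl⟩ := Finset.mem_map.1 hρ
    obtain ⟨_, ⟨v', hv', rfl⟩, hdim, hmem⟩ := hcones ρ' hρ'
    have hmap := Toric.normalCone_eq_map ξ.toEquiv (Toric.realDual m₀) hP v'
    refine ⟨_, ⟨_, (hP v').1 hv', rfl⟩, ?_, ?_⟩
    · rw [ξ.toEquiv.finrank_eq, ← hdim, hmap, Toric.coneDim_map_realEquiv]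
    · rintro ρ₁ ⟨hρ₁, hne⟩
      obtain ⟨ρ₁', hJ, rfl⟩ := ξ.exists_rayPreimage_of_mem_J hρ₁
      have h1 := hmem ρ₁' ⟨hJ, fun h => hne (congrArg ξ.rayPreimage h)⟩
      rw [hmap] at h1
      obtain ⟨x, hx, hxρ⟩ := h1
      have : x = Toric.latticePt (ξ.rayPreimage ρ₁').1 :=
        (Toric.realEquiv ξ.toEquiv).injective (hxρ.trans (ξ.realEquiv_rayPreimage ρ₁').symm)
      exact this ▸ hx
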